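/- \textbf{Conventions.} If $E,F$ are equivalence relations on spaces $X,Y$ with Borel structure, then $E$ is \emph{Borel reducible} to $F$ if there is a Borel function $f\colon X\to Y$ with $x\mathrel{E}x'\iff f(x)\mathrel{F}f(x')$ for all $x,x'\in X$. Countable structures are coded as structures on $\mathbb N$ in a countable relational language; a \emph{class of countable structures} is an isomorphism-invariant Borel set of such codes. $E$ is \emph{Borel complete} if it is Borel reducible to the isomorphism relation on some class of countable structures and, conversely, the isomorphism relation on every class of countable structures is Borel reducible to $E$. Let $\mathcal P$ be the generic partial order, that is, the countable homogeneous partial order (every isomorphism between finite suborders extends to an automorphism) in which every finite partial order embeds. Let $\mathcal P=P_0\sqcup P_1\sqcup P_2$ be a partition into three dense subsets (for all $x<y$ in $\mathcal P$ and every $i$ there is $z\in P_i$ with $x<z<y$). The \emph{generic shuffled partial order} $\mathcal P(3)$ is the digraph on the underlying set of $\mathcal P$ defined as follows. If $x,y\in P_i$, then $x\to y\iff x<y$. If $x\in P_i$ and $y\in P_{i+1}$ (with $i\in\mathbb Z/3\mathbb Z$), then $x\to y\iff x>y$; $y\to x\iff x$ and $y$ are incomparable; and there is no edge between $x$ and $y\iff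 x<y$. The group $\mathrm{Aut}(\mathcal P(3))$ carries the Borel structure of the topology of pointwise convergence, the vertex set being discrete. \textbf{Theorem.} Such a $\mathcal P$ and such a partition exist, and for every choice of them the isomorphism relation on countable partial orders (coded as partial orders on $\mathbb N$) is Borel reducible to the conjugacy relation on $\mathrm{Aut}(\mathcal P(3))$. Moreover the conjugacy relation on $\mathrm{Aut}(\mathcal P(3))$ is Borel complete. -/

import Mathlib

/-! ### Borel reducibility and Borel completeness -/

/-- `E` is Borel reducible to `F`. -/
def BorelReducible {X Y : Type*} [MeasurableSpace X] [MeasurableSpace Y]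
    (E : Setoid X) (F : Setoid Y) : Prop :=
  ∃ f : X → Y, Measurable f ∧ ∀ x x' : X, E x x' ↔ F (f x) (f x')

/-- The space of relational structures with underlying set `ℕ` in the signature with relation
symbols indexed by `ι`, the `i`-th one having arity `a i`. It carries the product σ-algebra, which
for countable `ι` is the Borel σ-algebra of the product of the spaces `2 ^ (ℕ ^ a i)`. -/
abbrev CodedStructure {ι : Type} (a : ι → ℕ) : Type :=
  (i : ι) → (Fin (a i) → ℕ) → Prop

/-- Isomorphism of structures with underlying set `ℕ`. -/
def codedStructureIso {ι : Type} (a : ι → ℕ) : Setoid (CodedStructure a) where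
  r M N := ∃ σ : Equiv.Perm ℕ, ∀ (i : ι) (x : Fin (a i) → ℕ), M i x ↔ N i (fun k => σ (x k))
  iseqv :=
    { refl := fun _ => ⟨1, fun _ _ => Iff.rfl⟩
      symm := by
        rintro M N ⟨σ, h⟩
        exact ⟨σ.symm, fun i x => by simpa using (h i (fun k => σ.symm (x k))).symm⟩
      trans := by
        rintro M N K ⟨σ, h⟩ ⟨τ, h'⟩
        exact ⟨σ.trans τ, fun i x => (h i x).trans (h' i fun k => σ (x k))⟩ }

/-- A (Borel) class of countable structures: a Borel set of structures on `ℕ` that is closed under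
isomorphism. -/
def IsStructureClass {ι : Type} (a : ι → ℕ) (C : Set (CodedStructure a)) : Prop :=
  MeasurableSet C ∧ ∀ M N : CodedStructure a, codedStructureIso a M N → M ∈ C → N ∈ C

/-- The isomorphism relation on a class of countable structures. -/
def isoOnClass {ι : Type} (a : ι → ℕ) (C : Set (CodedStructure a)) : Setoid C :=
  (codedStructureIso a).comap Subtype.val

/-- `E` is Borel complete: it is Borel reducible to the isomorphism relation on some class of
countable structures, and the isomorphism relation on any class of countable structures is Borel
reducible to `E`. -/
def IsBorelComplete {X : Type*} [MeasurableSpace X] (E : Setoid X) : Prop :=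
  (∃ (ι : Type) (_ : Countable ι) (a : ι → ℕ) (C : Set (CodedStructure a)),
      IsStructureClass a C ∧ BorelReducible E (isoOnClass a C)) ∧
  ∀ (ι : Type) (_ : Countable ι) (a : ι → ℕ) (C : Set (CodedStructure a)),
      IsStructureClass a C → BorelReducible (isoOnClass a C) E

/-! ### Countable partial orders -/

/-- The space of partial orders with underlying set `ℕ`, a Borel subspace of `2 ^ (ℕ × ℕ)`. -/
abbrev CodedPartialOrder : Type := {r : ℕ → ℕ → Prop // IsPartialOrder ℕ r}

/-- Isomorphism of countable partial orders. -/
def partialOrderIso : Setoid CodedPartialOrder where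
  r P Q := Nonempty (P.1 ≃r Q.1)
  iseqv :=
    { refl := fun P => ⟨RelIso.refl P.1⟩
      symm := fun ⟨f⟩ => ⟨f.symm⟩
      trans := fun ⟨f⟩ ⟨g⟩ => ⟨f.trans g⟩ }

/-! ### The generic partial order and the generic shuffled partial order -/

/-- `P` is the generic countable homogeneous partial order (the Fraïssé limit of the class of
finite partial orders): it is countable, every finite partial order embeds in it, and every
isomorphism between finite suborders extends to an automorphism. -/
structure IsGenericPartialOrder (P : Type*) [PartialOrder P] : Prop where
  countable : Countable P
  universal : ∀ (A : Type) [PartialOrder A] [Finite A], Nonempty (A ↪o P)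
  homogeneous : ∀ s : Set P, s.Finite → ∀ f : s ↪o P, ∃ g : P ≃o P, ∀ x : s, g x = f x

/-- A subset `D` of a partial order is dense: it meets every nondegenerate open interval
`(x, y)` with `x < y`. -/
def IsOrderDense {P : Type*} [PartialOrder P] (D : Set P) : Prop :=
  ∀ x y : P, x < y → ∃ z ∈ D, x < z ∧ z < y

/-- The shuffle of a partial order partitioned into the three color classes of
`c : P → ℤ/3ℤ`. For `x, y` of the same color, `x → y` iff `x < y`. For `x` of color `i` and `y` of
color `i + 1`: `x → y` iff `x > y`, `y → x` iff `x` and `y` are incomparable, and there is no edge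
between `x` and `y` iff `x < y`. -/
def shuffledDigraph {P : Type*} [PartialOrder P] (c : P → ZMod 3) : Digraph P where
  Adj x y :=
    (c y = c x ∧ x < y) ∨
    (c y = c x + 1 ∧ y < x) ∨
    (c x = c y + 1 ∧ ¬ x ≤ y ∧ ¬ y ≤ x)

/-- `G` is (a copy of) the generic shuffled partial order: the shuffle of the generic partial order
partitioned into three dense subsets. -/
def IsGenericShuffledPartialOrder {V : Type*} (G : Digraph V) : Prop :=
  ∃ (_ : PartialOrder V) (c : V → ZMod 3),
    IsGenericPartialOrder V ∧ (∀ i : ZMod 3, IsOrderDense {x | c x = i}) ∧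
      G = shuffledDigraph c

/-! ### Automorphism groups and conjugacy -/

/-- The automorphism group of a digraph. -/
abbrev DigraphAut {V : Type*} (G : Digraph V) : Type _ := G.Adj ≃r G.Adj

/-- The topology of pointwise convergence on the automorphism group, the vertex set being
discrete. -/
abbrev digraphAutTopology {V : Type*} (G : Digraph V) : TopologicalSpace (DigraphAut G) :=
  TopologicalSpace.induced (fun (φ : DigraphAut G) (x : V) => φ x)
    (@Pi.topologicalSpace V (fun _ => V) (fun _ => ⊥))

/-- The Borel σ-algebra of the automorphism group. -/
instance digraphAutMeasurableSpace {V : Type*} (G : Digraph V) :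
    MeasurableSpace (DigraphAut G) :=
  @borel (DigraphAut G) (digraphAutTopology G)

/-- The conjugacy relation on the automorphism group. -/
def conjugacy {V : Type*} (G : Digraph V) : Setoid (DigraphAut G) :=
  IsConj.setoid (DigraphAut G)

/-! To a partial order X on ℕ adjoin freely, over and over, points of each color indexed by ℤ
between finite families L < U. The resulting order F(X) has the one-point extension property in
every color, and so has the generic order with its three dense parts
(`FreeTerm.hasExtensionProperty`, `IsGenericPartialOrder.hasExtensionProperty`). Back-and-forth
therefore identifies the two, colors included (`exists_measurable_equiv`).

Raising every index by one is a color-preserving automorphism of F(X) that fixes exactly the points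
of X. Transported, it is an automorphism of the shuffled digraph, and this is the reduction. An
isomorphism from X to Y extends to one from F(X) to F(Y) commuting with the shifts, hence gives a
conjugacy. Conversely, a conjugating digraph automorphism matches the fixed points of the two
shifts. All of these have color 0, so the edges among them are the strict orders of X and Y; whether
the conjugator respects the generic order or the colors plays no role.

The construction is Borel because the terms form one countable set independent of X: a term with
inconsistent bounds is kept, and its bounds are ignored. Comparison of terms is a recursion on size,
and back-and-forth makes least choices.

For Borel completeness, countable structures are coded by partial orders containing an infinite
ascending chain that every isomorphism fixes pointwise (`CodingNode.iso_chain`), so that the number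
of chain elements below a node is an invariant label. In the other direction an automorphism is
coded by its graph together with the edge relation. -/

/-! ### Free one-point extensions of a countable partial order -/

/-- Terms naming the points obtained from base points by iterated one-point extensions: the term
`new L U i k` names the `k`-th new point of color `i` placed above all `L a` and below all `U b`. -/
inductive FreeTerm : Type
  | base : ℕ → FreeTerm
  | new {m n : ℕ} (L : Fin m → FreeTerm) (U : Fin n → FreeTerm) (i : ZMod 3) (k : ℤ) : FreeTerm

namespace FreeTerm

/-- The argument positions of a term constructor. -/
def Slot : ℕ ⊕ (ℕ × ℕ × ZMod 3 × ℤ) → Type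
  | .inl _ => Empty
  | .inr p => Fin p.1 ⊕ Fin p.2.1

instance : ∀ a, Fintype (Slot a)
  | .inl _ => inferInstanceAs (Fintype Empty)
  | .inr p => inferInstanceAs (Fintype (Fin p.1 ⊕ Fin p.2.1))

instance : ∀ a, Encodable (Slot a)
  | .inl _ => inferInstanceAs (Encodable Empty)
  | .inr p => inferInstanceAs (Encodable (Fin p.1 ⊕ Fin p.2.1))

/-- The term with a given constructor and given arguments. -/
def ofSlots : (Σ a, Slot a → FreeTerm) → FreeTerm
  | ⟨.inl n, _⟩ => base n
  | ⟨.inr p, f⟩ => new (fun a => f (Sum.inl a)) (fun b => f (Sum.inr b)) p.2.2.1 p.2.2.2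

instance : Countable FreeTerm := by
  have : Encodable (ZMod 3) := inferInstanceAs (Encodable (Fin 3))
  have hs : Function.Surjective (WType.elim FreeTerm ofSlots) := by
    intro t
    induction t with
    | base n => exact ⟨WType.mk (Sum.inl n) Empty.elim, rfl⟩
    | new L U i k hL hU =>
      choose l hl using hL
      choose u hu using hU
      refine ⟨WType.mk (Sum.inr (_, _, i, k)) (Sum.elim l u), ?_⟩
      simp [WType.elim, ofSlots, hl, hu]
  exact hs.countable

/-- The size of a term, counting also the absolute values of its integer indices. -/
def size : FreeTerm → ℕ
  | base _ => 0
  | new L U _ k => 1 + k.natAbs + ∑ a, size (L a) + ∑ b, size (U b)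

/-- The color of a term. -/
def color : FreeTerm → ZMod 3
  | base _ => 0
  | new _ _ i _ => i

/-- The action of a map of base points and an integer shift on terms. -/
def map (σ : ℕ → ℕ) (t : ℤ) : FreeTerm → FreeTerm
  | base n => base (σ n)
  | new L U i k => new (fun a => map σ t (L a)) (fun b => map σ t (U b)) i (k + t)

/-- The strict order on terms generated by the strict part of `r` on base points and by
`L a < new L U i k < U b` whenever all `L a` are less than all `U b`. -/
inductive Lt (r : ℕ → ℕ → Prop) : FreeTerm → FreeTerm → Prop
  | base {m n : ℕ} (h : r m n) (hne : m ≠ n) : Lt r (base m) (base n)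
  | lower {p q : ℕ} {L : Fin p → FreeTerm} {U : Fin q → FreeTerm} {i : ZMod 3} {k : ℤ}
      (hv : ∀ a b, Lt r (L a) (U b)) (a : Fin p) : Lt r (L a) (new L U i k)
  | belowLower {p q : ℕ} {L : Fin p → FreeTerm} {U : Fin q → FreeTerm} {i : ZMod 3} {k : ℤ}
      (hv : ∀ a b, Lt r (L a) (U b)) (a : Fin p) {x : FreeTerm} (h : Lt r x (L a)) :
      Lt r x (new L U i k)
  | upper {p q : ℕ} {L : Fin p → FreeTerm} {U : Fin q → FreeTerm} {i : ZMod 3} {k : ℤ}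
      (hv : ∀ a b, Lt r (L a) (U b)) (b : Fin q) : Lt r (new L U i k) (U b)
  | aboveUpper {p q : ℕ} {L : Fin p → FreeTerm} {U : Fin q → FreeTerm} {i : ZMod 3} {k : ℤ}
      (hv : ∀ a b, Lt r (L a) (U b)) (b : Fin q) {y : FreeTerm} (h : Lt r (U b) y) :
      Lt r (new L U i k) y

/-- The reflexive closure of `Lt`. -/
def Le (r : ℕ → ℕ → Prop) (x y : FreeTerm) : Prop := x = y ∨ Lt r x y

/-! ### Size bounds and inversion rules for the free order -/

section basic

variable {r : ℕ → ℕ → Prop} {p q p' q' : ℕ} {L : Fin p → FreeTerm} {U : Fin q → FreeTerm}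
  {L' : Fin p' → FreeTerm} {U' : Fin q' → FreeTerm} {i i' : ZMod 3} {k k' : ℤ}

theorem size_lower_lt (L : Fin p → FreeTerm) (U : Fin q → FreeTerm) (i : ZMod 3) (k : ℤ)
    (a : Fin p) : size (L a) < size (new L U i k) := by
  have := Finset.single_le_sum (f := fun a => size (L a)) (fun _ _ => Nat.zero_le _)
    (Finset.mem_univ a)
  simp only [size]
  omega

theorem size_upper_lt (L : Fin p → FreeTerm) (U : Fin q → FreeTerm) (i : ZMod 3) (k : ℤ)
    (b : Fin q) : size (U b) < size (new L U i k) := by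
  have := Finset.single_le_sum (f := fun b => size (U b)) (fun _ _ => Nat.zero_le _)
    (Finset.mem_univ b)
  simp only [size]
  omega

theorem size_lower_add_upper_lt (L : Fin p → FreeTerm) (U : Fin q → FreeTerm) (i : ZMod 3)
    (k : ℤ) (a : Fin p) (b : Fin q) : size (L a) + size (U b) < size (new L U i k) := by
  have h₁ := Finset.single_le_sum (f := fun a => size (L a)) (fun _ _ => Nat.zero_le _)
    (Finset.mem_univ a)
  have h₂ := Finset.single_le_sum (f := fun b => size (U b)) (fun _ _ => Nat.zero_le _)
    (Finset.mem_univ b)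
  simp only [size]
  omega

theorem Lt.of_le_lower (hv : ∀ a b, Lt r (L a) (U b)) {x : FreeTerm} {a : Fin p}
    (h : Le r x (L a)) : Lt r x (new L U i k) := by
  rcases h with rfl | h
  exacts [.lower hv a, .belowLower hv a h]

theorem Lt.of_upper_le (hv : ∀ a b, Lt r (L a) (U b)) {y : FreeTerm} {b : Fin q}
    (h : Le r (U b) y) : Lt r (new L U i k) y := by
  rcases h with rfl | h
  exacts [.upper hv b, .aboveUpper hv b h]

/-- The three ways in which `x < y` can arise. -/
theorem Lt.cases_of {x y : FreeTerm} (h : Lt r x y) :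
    (∃ m n, x = .base m ∧ y = .base n ∧ r m n ∧ m ≠ n) ∨
    (∃ (p q : ℕ) (L : Fin p → FreeTerm) (U : Fin q → FreeTerm) (i : ZMod 3) (k : ℤ),
      y = new L U i k ∧ (∀ a b, Lt r (L a) (U b)) ∧ ∃ a, Le r x (L a)) ∨
    (∃ (p q : ℕ) (L : Fin p → FreeTerm) (U : Fin q → FreeTerm) (i : ZMod 3) (k : ℤ),
      x = new L U i k ∧ (∀ a b, Lt r (L a) (U b)) ∧ ∃ b, Le r (U b) y) := by
  cases h with
  | base h hne => exact Or.inl ⟨_, _, rfl, rfl, h, hne⟩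
  | lower hv a => exact Or.inr (Or.inl ⟨_, _, _, _, _, _, rfl, hv, a, Or.inl rfl⟩)
  | belowLower hv a h => exact Or.inr (Or.inl ⟨_, _, _, _, _, _, rfl, hv, a, Or.inr h⟩)
  | upper hv b => exact Or.inr (Or.inr ⟨_, _, _, _, _, _, rfl, hv, b, Or.inl rfl⟩)
  | aboveUpper hv b h => exact Or.inr (Or.inr ⟨_, _, _, _, _, _, rfl, hv, b, Or.inr h⟩)

theorem lt_base_base {m n : ℕ} : Lt r (.base m) (.base n) ↔ r m n ∧ m ≠ n := by
  constructor
  · intro h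
    rcases h.cases_of with ⟨_, _, h, h', h''⟩ | ⟨_, _, _, _, _, _, h, -⟩ | ⟨_, _, _, _, _, _, h, -⟩
    · cases h
      cases h'
      exact h''
    all_goals cases h
  · exact fun h => .base h.1 h.2

theorem lt_base_new {m : ℕ} : Lt r (.base m) (new L U i k) ↔
    (∀ a b, Lt r (L a) (U b)) ∧ ∃ a, Le r (.base m) (L a) := by
  constructor
  · intro h
    rcases h.cases_of with ⟨_, _, _, h, -⟩ | ⟨_, _, _, _, _, _, h, h'⟩ | ⟨_, _, _, _, _, _, h, -⟩ <;>
      cases h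
    exact h'
  · rintro ⟨hv, a, h⟩
    exact .of_le_lower hv h

theorem lt_new_base {m : ℕ} : Lt r (new L U i k) (.base m) ↔
    (∀ a b, Lt r (L a) (U b)) ∧ ∃ b, Le r (U b) (.base m) := by
  constructor
  · intro h
    rcases h.cases_of with ⟨_, _, h, -⟩ | ⟨_, _, _, _, _, _, h, -⟩ | ⟨_, _, _, _, _, _, h, h'⟩ <;>
      cases h
    exact h'
  · rintro ⟨hv, a, h⟩
    exact .of_upper_le hv h

theorem lt_new_new : Lt r (new L U i k) (new L' U' i' k') ↔
    ((∀ a b, Lt r (L' a) (U' b)) ∧ ∃ a, Le r (new L U i k) (L' a)) ∨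
    ((∀ a b, Lt r (L a) (U b)) ∧ ∃ b, Le r (U b) (new L' U' i' k')) := by
  constructor
  · intro h
    rcases h.cases_of with ⟨_, _, h, -⟩ | ⟨_, _, _, _, _, _, h, h'⟩ | ⟨_, _, _, _, _, _, h, h'⟩ <;>
      cases h
    exacts [Or.inl h', Or.inr h']
  · rintro (⟨hv, a, h⟩ | ⟨hv, a, h⟩)
    exacts [.of_le_lower hv h, .of_upper_le hv h]

end basic

/-! ### Order axioms and measurability of the free order -/

section order

variable {r : ℕ → ℕ → Prop}

/-- Induction on total size. The essential case has a new point y in the middle, with x ≤ `L a` and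
`U b'` ≤ z: then y is replaced by the comparison `L a` < `U b'`, whose terms together are smaller
than y. In the other cases one of the outer terms is replaced by a bound of it, or all three are
base points. -/
theorem lt_trans_aux (hr : IsPartialOrder ℕ r) (N : ℕ) : ∀ x y z : FreeTerm,
    size x + size y + size z < N → Lt r x y → Lt r y z → Lt r x z := by
  induction N with
  | zero => intro x y z h; omega
  | succ N ih =>
    intro x y z hN hxy hyz
    rcases hxy.cases_of with ⟨m, n, rfl, rfl, hmn, hne⟩ |
      ⟨p, q, L, U, i, k, rfl, hv, a, ha⟩ | ⟨p, q, L, U, i, k, rfl, hv, b, hb⟩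
    · rcases hyz.cases_of with ⟨m', n', hm', rfl, hmn', hne'⟩ |
        ⟨p, q, L, U, i, k, rfl, hv, a, ha⟩ | ⟨p, q, L, U, i, k, h, -⟩
      · cases hm'
        refine .base (hr.trans _ _ _ hmn hmn') ?_
        rintro rfl
        exact hne (hr.antisymm _ _ hmn hmn')
      · refine .of_le_lower hv (a := a) (Or.inr ?_)
        rcases ha with ha | ha
        · exact ha ▸ hxy
        · have := size_lower_lt L U i k a
          exact ih _ _ _ (by omega) hxy ha
      · cases h
    · rcases hyz.cases_of with ⟨m', n', hm', -⟩ |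
        ⟨p', q', L', U', i', k', rfl, hv', a', ha'⟩ | ⟨p', q', L', U', i', k', h, hv', b', hb'⟩
      · cases hm'
      · refine .of_le_lower hv' (a := a') (Or.inr ?_)
        rcases ha' with ha' | ha'
        · exact ha' ▸ hxy
        · have := size_lower_lt L' U' i' k' a'
          exact ih _ _ _ (by omega) hxy ha'
      · cases h
        have h₁ := size_lower_add_upper_lt L U i k a b'
        have h₂ : Lt r x (U b') := by
          rcases ha with rfl | ha
          · exact hv _ _
          · exact ih _ _ _ (by omega) ha (hv a b')
        rcases hb' with rfl | hb'
        · exact h₂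
        · exact ih _ _ _ (by omega) h₂ hb'
    · refine .of_upper_le hv (b := b) (Or.inr ?_)
      rcases hb with hb | hb
      · exact hb ▸ hyz
      · have := size_upper_lt L U i k b
        exact ih _ _ _ (by omega) hb hyz

theorem Lt.trans (hr : IsPartialOrder ℕ r) {x y z : FreeTerm} (h : Lt r x y) (h' : Lt r y z) :
    Lt r x z :=
  lt_trans_aux hr _ x y z (Nat.lt_succ_self _) h h'

/-- A loop at a new point would have to pass through one of its bounds, which would then lie
strictly below itself. -/
theorem Lt.irrefl (hr : IsPartialOrder ℕ r) (x : FreeTerm) : ¬ Lt r x x := by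
  induction x with
  | base n => exact fun h => (lt_base_base.1 h).2 rfl
  | new L U i k hL hU =>
    intro h
    rcases lt_new_new.1 h with ⟨hv, a, ha⟩ | ⟨hv, b, hb⟩
    · have h₁ : Lt r (L a) (new L U i k) := .lower hv a
      rcases ha with ha | ha
      · exact hL a (by rwa [ha] at h₁)
      · exact hL a (h₁.trans hr ha)
    · have h₁ : Lt r (new L U i k) (U b) := .upper hv b
      rcases hb with hb | hb
      · exact hU b (by rwa [← hb] at h₁)
      · exact hU b (hb.trans hr h₁)

theorem Le.trans (hr : IsPartialOrder ℕ r) {x y z : FreeTerm} (h : Le r x y) (h' : Le r y z) :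
    Le r x z := by
  rcases h with rfl | h
  · exact h'
  · rcases h' with rfl | h'
    exacts [Or.inr h, Or.inr (h.trans hr h')]

theorem isPartialOrder_le (hr : IsPartialOrder ℕ r) : IsPartialOrder FreeTerm (Le r) where
  refl _ := Or.inl rfl
  trans _ _ _ := Le.trans hr
  antisymm x y h h' := by
    rcases h with h | h
    · exact h
    · rcases h' with h' | h'
      · exact h'.symm
      · exact absurd (h.trans hr h') (Lt.irrefl hr x)

theorem lt_iff_le_and_ne (hr : IsPartialOrder ℕ r) {x y : FreeTerm} :
    Lt r x y ↔ Le r x y ∧ x ≠ y :=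
  ⟨fun h => ⟨Or.inr h, by rintro rfl; exact Lt.irrefl hr _ h⟩,
    fun h => h.1.resolve_left h.2⟩

/-- The inversion rules express each comparison by countably many comparisons of smaller total size,
ending in the relation on base points. -/
theorem measurableSet_lt {Ω : Type*} [MeasurableSpace Ω] {r : Ω → ℕ → ℕ → Prop}
    (hr : ∀ m n, MeasurableSet {ω | r ω m n}) (x y : FreeTerm) :
    MeasurableSet {ω | Lt (r ω) x y} := by
  suffices H : ∀ N, ∀ x y : FreeTerm, size x + size y < N → MeasurableSet {ω | Lt (r ω) x y} from
    H _ x y (Nat.lt_succ_self _)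
  intro N
  induction N with
  | zero => intro x y h; omega
  | succ N ih =>
    have ihle : ∀ x y : FreeTerm, size x + size y < N → MeasurableSet {ω | Le (r ω) x y} :=
      fun x y h => (MeasurableSet.const _).union (ih x y h)
    have hval : ∀ {p q : ℕ} (L : Fin p → FreeTerm) (U : Fin q → FreeTerm) (i : ZMod 3) (k : ℤ),
        size (new L U i k) < N + 1 → MeasurableSet {ω | ∀ a b, Lt (r ω) (L a) (U b)} := by
      intro p q L U i k h
      simp only [Set.ofPred_forall]
      refine .iInter fun a => .iInter fun b => ih _ _ ?_
      have := size_lower_add_upper_lt L U i k a b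
      omega
    rintro (m | ⟨L, U, i, k⟩) (n | ⟨L', U', i', k'⟩) h
    · simp only [lt_base_base]
      exact (hr m n).inter (.const _)
    · simp only [lt_base_new, Set.ofPred_and, Set.ofPred_exists]
      refine (hval L' U' i' k' (by omega)).inter (.iUnion fun a => ihle _ _ ?_)
      have := size_lower_lt L' U' i' k' a
      omega
    · simp only [lt_new_base, Set.ofPred_and, Set.ofPred_exists]
      refine (hval L U i k (by omega)).inter (.iUnion fun a => ihle _ _ ?_)
      have := size_upper_lt L U i k a
      omega
    · simp only [lt_new_new, Set.ofPred_or, Set.ofPred_and, Set.ofPred_exists]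
      refine ((hval L' U' i' k' (by omega)).inter (.iUnion fun a => ihle _ _ ?_)).union
        ((hval L U i k (by omega)).inter (.iUnion fun a => ihle _ _ ?_))
      · have := size_lower_lt L' U' i' k' a
        omega
      · have := size_upper_lt L U i k a
        omega

theorem measurableSet_le {Ω : Type*} [MeasurableSpace Ω] {r : Ω → ℕ → ℕ → Prop}
    (hr : ∀ m n, MeasurableSet {ω | r ω m n}) (x y : FreeTerm) :
    MeasurableSet {ω | Le (r ω) x y} :=
  (MeasurableSet.const _).union (measurableSet_lt hr x y)

/-- Below a new point, the terms that are not larger than it lie below one of its lower bounds. -/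
theorem Lt.exists_le_lower {p q : ℕ} {L : Fin p → FreeTerm}
    {U : Fin q → FreeTerm} {i : ZMod 3} {k : ℤ} {x : FreeTerm}
    (hx : size x ≤ size (new L U i k)) (h : Lt r x (new L U i k)) : ∃ a, Le r x (L a) := by
  induction x with
  | base n => exact (lt_base_new.1 h).2
  | new L' U' i' k' hL hU =>
    rcases lt_new_new.1 h with ⟨-, h⟩ | ⟨hv, b, hb⟩
    · exact h
    -- An upper bound of `x` is smaller than `x`, so it cannot be the new point itself; it lies
    -- strictly below, and induction applies to it.
    · have h₁ := size_upper_lt L' U' i' k' b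
      rcases hb with hb | hb
      · rw [hb] at h₁; omega
      · obtain ⟨a, ha⟩ := hU b (by omega) hb
        exact ⟨a, Or.inr (.of_upper_le hv ha)⟩

/-- Above a new point, the terms that are not larger than it lie above one of its upper bounds. -/
theorem Lt.exists_upper_le {p q : ℕ} {L : Fin p → FreeTerm}
    {U : Fin q → FreeTerm} {i : ZMod 3} {k : ℤ} {x : FreeTerm}
    (hx : size x ≤ size (new L U i k)) (h : Lt r (new L U i k) x) : ∃ b, Le r (U b) x := by
  induction x with
  | base n => exact (lt_new_base.1 h).2
  | new L' U' i' k' hL hU =>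
    rcases lt_new_new.1 h with ⟨hv, b, hb⟩ | ⟨-, h⟩
    · have h₁ := size_lower_lt L' U' i' k' b
      rcases hb with hb | hb
      · rw [← hb] at h₁; omega
      · obtain ⟨a, ha⟩ := hL b (by omega) hb
        exact ⟨a, Or.inr (.of_le_lower hv ha)⟩
    · exact h

end order

/-! ### Relabelling of base points and the index shift -/

section map

theorem map_map (σ τ : ℕ → ℕ) (s t : ℤ) (x : FreeTerm) :
    map σ s (map τ t x) = map (σ ∘ τ) (t + s) x := by
  induction x with
  | base n => rfl
  | new L U i k hL hU => simp only [map, hL, hU, add_assoc]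

theorem map_id (x : FreeTerm) : map id 0 x = x := by
  induction x with
  | base n => rfl
  | new L U i k hL hU => simp only [map, hL, hU, add_zero]

theorem color_map (σ : ℕ → ℕ) (t : ℤ) (x : FreeTerm) : color (map σ t x) = color x := by
  cases x <;> rfl

/-- The generating rules ignore the integer indices, so all of them may be shifted at once;
injectivity keeps comparisons of base points strict. -/
theorem Lt.map {r s : ℕ → ℕ → Prop} {σ : ℕ → ℕ} (hσ : Function.Injective σ)
    (h : ∀ m n, r m n → s (σ m) (σ n)) (t : ℤ) {x y : FreeTerm} (hxy : Lt r x y) :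
    Lt s (map σ t x) (map σ t y) := by
  induction hxy with
  | base hmn hne => exact .base (h _ _ hmn) (hσ.ne hne)
  | lower hv a ih => exact .lower (L := fun a => FreeTerm.map σ t _) ih a
  | belowLower hv a _ ih ih' => exact .belowLower (L := fun a => FreeTerm.map σ t _) ih a ih'
  | upper hv b ih => exact .upper (U := fun a => FreeTerm.map σ t _) ih b
  | aboveUpper hv b _ ih ih' => exact .aboveUpper (U := fun a => FreeTerm.map σ t _) ih b ih'

/-- The permutation of the terms induced by a permutation of the base points and a shift. -/
def mapEquiv (σ : Equiv.Perm ℕ) (t : ℤ) : Equiv.Perm FreeTerm where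
  toFun := map σ t
  invFun := map σ.symm (-t)
  left_inv x := by simp [map_map, map_id]
  right_inv x := by simp [map_map, map_id]

theorem le_mapEquiv {r s : ℕ → ℕ → Prop} (σ : Equiv.Perm ℕ) (t : ℤ)
    (h : ∀ m n, r m n ↔ s (σ m) (σ n)) (x y : FreeTerm) :
    Le s (mapEquiv σ t x) (mapEquiv σ t y) ↔ Le r x y := by
  constructor
  · rintro (hxy | hxy)
    · exact Or.inl ((mapEquiv σ t).injective hxy)
    · have := hxy.map (s := r) σ.symm.injective (fun m n hmn => (h _ _).2 (by simpa using hmn)) (-t)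
      have e := (mapEquiv σ t).symm_apply_apply
      exact Or.inr ((congrArg₂ (Lt r) (e x) (e y)).mp this)
  · rintro (rfl | hxy)
    · exact Or.inl rfl
    · exact Or.inr (hxy.map σ.injective (fun m n => (h m n).1) t)

theorem mapEquiv_comm (σ : Equiv.Perm ℕ) (x : FreeTerm) :
    mapEquiv σ 0 (mapEquiv 1 1 x) = mapEquiv 1 1 (mapEquiv σ 0 x) := by
  change map σ 0 (map (1 : Equiv.Perm ℕ) 1 x) = map (1 : Equiv.Perm ℕ) 1 (map σ 0 x)
  rw [map_map, map_map]
  rfl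

/-- The shift changes the outermost index of every new term. Its fixed points thus recover the
original order inside the free extension. -/
theorem mapEquiv_eq_self_iff (x : FreeTerm) : mapEquiv 1 1 x = x ↔ ∃ n, x = base n := by
  cases x with
  | base n => exact ⟨fun _ => ⟨n, rfl⟩, fun _ => rfl⟩
  | new L U i k =>
    constructor
    · intro h
      change new _ _ _ (k + 1) = new _ _ _ k at h
      injection h with _ _ _ _ _ h
      omega
    · rintro ⟨n, h⟩
      cases h

end map

end FreeTerm

/-! ### Partial isomorphisms and back-and-forth -/

/-- The extension property of a colored partial order `(P, r, c)`: every consistent one-point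
extension of a finite suborder is realized by points of every color. -/
def HasExtensionProperty {P C : Type*} (r : P → P → Prop) (c : P → C) : Prop :=
  ∀ L U I : Set P, L.Finite → U.Finite → I.Finite →
    (∀ a ∈ L, ∀ b ∈ U, r a b ∧ a ≠ b) → (∀ x ∈ I, ∀ a ∈ L, ¬ r x a) → (∀ x ∈ I, ∀ b ∈ U, ¬ r b x) →
    ∀ i : C, ∃ z, c z = i ∧ (∀ a ∈ L, r a z ∧ a ≠ z) ∧ (∀ b ∈ U, r z b ∧ z ≠ b) ∧
      ∀ x ∈ I, ¬ r x z ∧ ¬ r z x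

/-- The pairs in the list `l` constitute a partial isomorphism of colored orders. -/
def IsPartialIso {P Q C : Type*} (r : P → P → Prop) (c : P → C) (s : Q → Q → Prop) (d : Q → C)
    (l : List (P × Q)) : Prop :=
  ∀ p ∈ l, c p.1 = d p.2 ∧ ∀ q ∈ l, r p.1 q.1 ↔ s p.2 q.2

section PartialIso

variable {P Q C : Type*} {r : P → P → Prop} {c : P → C} {s : Q → Q → Prop} {d : Q → C}
  {l : List (P × Q)}

theorem IsPartialIso.swap (h : IsPartialIso r c s d l) :
    IsPartialIso s d r c (l.map Prod.swap) := by
  intro p' hp'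
  obtain ⟨p, hp, rfl⟩ := List.mem_map.1 hp'
  refine ⟨(h p hp).1.symm, fun q' hq' => ?_⟩
  obtain ⟨q, hq, rfl⟩ := List.mem_map.1 hq'
  exact ((h p hp).2 q hq).symm

theorem IsPartialIso.fst_eq_iff (hr : IsPartialOrder P r) (hs : IsPartialOrder Q s)
    (h : IsPartialIso r c s d l) {p q : P × Q} (hp : p ∈ l) (hq : q ∈ l) :
    p.1 = q.1 ↔ p.2 = q.2 := by
  have h₁ := (h p hp).2 q hq
  have h₂ := (h q hq).2 p hp
  constructor
  · intro e
    exact hs.antisymm _ _ (h₁.1 (e ▸ hr.refl _)) (h₂.1 (e ▸ hr.refl _))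
  · intro e
    exact hr.antisymm _ _ (h₁.2 (e ▸ hs.refl _)) (h₂.2 (e ▸ hs.refl _))

/-- The second coordinates are sorted by whether their partners lie below, above or beside `x`; the
extension property supplies a point in the corresponding position, with the color of `x`. -/
theorem IsPartialIso.exists_cons (hr : IsPartialOrder P r) (hs : IsPartialOrder Q s)
    (hext : HasExtensionProperty s d) (h : IsPartialIso r c s d l) (x : P) :
    ∃ l', l ⊆ l' ∧ IsPartialIso r c s d l' ∧ ∃ y, (x, y) ∈ l' := by
  by_cases hx : ∃ y, (x, y) ∈ l
  · exact ⟨l, fun _ => id, h, hx⟩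
  have hne : ∀ p ∈ l, p.1 ≠ x := fun p hp e => hx ⟨p.2, e ▸ hp⟩
  have hfin : ∀ A : P → Prop, {y | ∃ p ∈ l, A p.1 ∧ p.2 = y}.Finite := fun A =>
    ((List.finite_toSet l).image Prod.snd).subset (by
      rintro y ⟨p, hp, -, rfl⟩
      exact ⟨p, hp, rfl⟩)
  obtain ⟨y, hy, hL, hU, hI⟩ := hext _ _ _ (hfin fun a => r a x) (hfin fun a => r x a)
    (hfin fun a => ¬ r a x ∧ ¬ r x a)
    (by
      rintro _ ⟨p, hp, hpx, rfl⟩ _ ⟨q, hq, hqx, rfl⟩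
      refine ⟨((h p hp).2 q hq).1 (hr.trans _ _ _ hpx hqx), fun e => hne p hp ?_⟩
      have e' := (h.fst_eq_iff hr hs hp hq).2 e
      exact hr.antisymm _ _ hpx (e' ▸ hqx))
    (by
      rintro _ ⟨p, hp, hpx, rfl⟩ _ ⟨q, hq, hqx, rfl⟩ hpq
      exact hpx.1 (hr.trans _ _ _ (((h p hp).2 q hq).2 hpq) hqx))
    (by
      rintro _ ⟨p, hp, hpx, rfl⟩ _ ⟨q, hq, hqx, rfl⟩ hqp
      exact hpx.2 (hr.trans _ _ _ hqx (((h q hq).2 p hp).2 hqp)))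
    (c x)
  have key : ∀ p ∈ l, (r p.1 x ↔ s p.2 y) ∧ (r x p.1 ↔ s y p.2) := by
    intro p hp
    by_cases h₁ : r p.1 x
    · have h₂ : ¬ r x p.1 := fun h₂ => hne p hp (hr.antisymm _ _ h₁ h₂)
      have h₃ := hL _ ⟨p, hp, h₁, rfl⟩
      exact ⟨iff_of_true h₁ h₃.1, iff_of_false h₂ fun h₄ => h₃.2 (hs.antisymm _ _ h₃.1 h₄)⟩
    · by_cases h₂ : r x p.1
      · have h₃ := hU _ ⟨p, hp, h₂, rfl⟩
        exact ⟨iff_of_false h₁ fun h₄ => h₃.2 (hs.antisymm _ _ h₃.1 h₄), iff_of_true h₂ h₃.1⟩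
      · have h₃ := hI _ ⟨p, hp, ⟨h₁, h₂⟩, rfl⟩
        exact ⟨iff_of_false h₁ h₃.1, iff_of_false h₂ h₃.2⟩
  refine ⟨(x, y) :: l, List.subset_cons_self _ _, ?_, y, List.mem_cons_self⟩
  intro p hp
  rcases List.mem_cons.1 hp with rfl | hp
  · refine ⟨hy.symm, fun q hq => ?_⟩
    rcases List.mem_cons.1 hq with rfl | hq
    · exact iff_of_true (hr.refl _) (hs.refl _)
    · exact (key q hq).2
  · refine ⟨(h p hp).1, fun q hq => ?_⟩
    rcases List.mem_cons.1 hq with rfl | hq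
    · exact (key p hp).1
    · exact (h p hp).2 q hq

theorem IsPartialIso.exists_cons_snd (hr : IsPartialOrder P r) (hs : IsPartialOrder Q s)
    (hext : HasExtensionProperty r c) (h : IsPartialIso r c s d l) (y : Q) :
    ∃ l', l ⊆ l' ∧ IsPartialIso r c s d l' ∧ ∃ x, (x, y) ∈ l' := by
  obtain ⟨l', hl, hl', x, hx⟩ := h.swap.exists_cons hs hr hext y
  refine ⟨l'.map Prod.swap, fun p hp => ?_, hl'.swap, x, List.mem_map.2 ⟨_, hx, rfl⟩⟩
  exact List.mem_map.2 ⟨p.swap, hl (List.mem_map.2 ⟨p, hp, rfl⟩), p.swap_swap⟩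

end PartialIso

/-- Measurable dependent choice in a countable set. -/
theorem exists_measurable_seq {Ω S : Type*} [MeasurableSpace Ω] [Countable S]
    (I : Ω → S → Prop) (T : ℕ → S → S → Prop) (s₀ : S)
    (hI : ∀ s, MeasurableSet {ω | I ω s}) (h₀ : ∀ ω, I ω s₀)
    (hstep : ∀ ω n s, I ω s → ∃ s', I ω s' ∧ T n s s') :
    ∃ f : ℕ → Ω → S, (∀ n s, MeasurableSet {ω | f n ω = s}) ∧ (∀ ω, f 0 ω = s₀) ∧
      (∀ n ω, I ω (f n ω)) ∧ ∀ n ω, T n (f n ω) (f (n + 1) ω) := by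
  classical
  obtain ⟨e, he⟩ := Countable.exists_injective_nat S
  -- The choice becomes a search for the least code under `e`. Stating the requirement as an
  -- implication makes the search total: where `I ω s` fails, `s` itself qualifies.
  have hex : ∀ ω n s, ∃ k, ∃ s', e s' = k ∧ (I ω s → I ω s' ∧ T n s s') := by
    intro ω n s
    by_cases h : I ω s
    · obtain ⟨s', h'⟩ := hstep ω n s h
      exact ⟨_, s', rfl, fun _ => h'⟩
    · exact ⟨_, s, rfl, fun h' => absurd h' h⟩
  choose next hnext hnext' using fun ω n s => Nat.find_spec (hex ω n s)
  have hmeas : ∀ n s s', MeasurableSet {ω | next ω n s = s'} := by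
    intro n s s'
    have h₁ : Measurable fun ω => Nat.find (hex ω n s) := by
      refine measurable_find _ fun k => ?_
      simp only [Set.ofPred_exists, Set.ofPred_and]
      refine .iUnion fun t => (MeasurableSet.const _).inter ?_
      exact (hI s).compl.union ((hI t).inter (.const (T n s t))) |>.congr (by
        ext ω; simp [imp_iff_not_or])
    have h₂ : {ω | next ω n s = s'} = (fun ω => Nat.find (hex ω n s)) ⁻¹' {e s'} := by
      ext ω
      simp only [Set.mem_preimage, Set.mem_singleton_iff, ← hnext]
      exact he.eq_iff.symm
    rw [h₂]
    exact h₁ (measurableSet_singleton _)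
  let f : ℕ → Ω → S := fun n ω => Nat.rec s₀ (fun n s => next ω n s) n
  have hfI : ∀ n ω, I ω (f n ω) := by
    intro n ω
    induction n with
    | zero => exact h₀ ω
    | succ n ih => exact (hnext' ω n _ ih).1
  refine ⟨f, fun n => ?_, fun _ => rfl, hfI, fun n ω => (hnext' ω n _ (hfI n ω)).2⟩
  induction n with
  | zero => exact fun s => .const (s₀ = s)
  | succ n ih =>
    intro s
    have : {ω | f (n + 1) ω = s} = ⋃ t, {ω | f n ω = t} ∩ {ω | next ω n t = s} := by
      ext ω
      simp [f]
    rw [this]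
    exact .iUnion fun t => (ih t).inter (hmeas n t s)

/-- Back-and-forth, measurably in a parameter: a measurable family of partial orders on a
countable set with the extension property is measurably isomorphic to any fixed countable partial
order with the extension property, extending a given finite partial isomorphism. -/
theorem exists_measurable_equiv {Ω P Q C : Type*} [MeasurableSpace Ω] [Countable P] [Countable Q]
    [Nonempty P] [Nonempty Q] {r : Ω → P → P → Prop} {c : P → C} {s : Q → Q → Prop} {d : Q → C}
    (hm : ∀ x y, MeasurableSet {ω | r ω x y})
    (hr : ∀ ω, IsPartialOrder P (r ω)) (hs : IsPartialOrder Q s)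
    (hextr : ∀ ω, HasExtensionProperty (r ω) c) (hexts : HasExtensionProperty s d)
    (l₀ : List (P × Q)) (hl₀ : ∀ ω, IsPartialIso (r ω) c s d l₀) :
    ∃ h : Ω → P ≃ Q, (∀ x y, MeasurableSet {ω | h ω x = y}) ∧
      (∀ ω x y, r ω x y ↔ s (h ω x) (h ω y)) ∧ (∀ ω x, d (h ω x) = c x) ∧
      ∀ ω, ∀ p ∈ l₀, h ω p.1 = p.2 := by
  obtain ⟨u, hu⟩ := exists_surjective_nat P
  obtain ⟨v, hv⟩ := exists_surjective_nat Q
  -- The states are finite partial isomorphisms, of which there are countably many; stage n puts `u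
  -- n` into the domain and `v n` into the range.
  obtain ⟨f, hfm, hf₀, hfI, hfT⟩ := exists_measurable_seq
    (fun ω l => IsPartialIso (r ω) c s d l)
    (fun n l l' => l ⊆ l' ∧ (∃ y, (u n, y) ∈ l') ∧ ∃ x, (x, v n) ∈ l') l₀
    (fun l => by
      simp only [IsPartialIso, Set.ofPred_forall, Set.ofPred_and]
      refine .iInter fun p => .iInter fun _ => (MeasurableSet.const _).inter
        (.iInter fun q => .iInter fun _ => ?_)
      by_cases h : s p.2 q.2
      · simpa [h] using hm p.1 q.1
      · simp only [h, iff_false]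
        exact (hm p.1 q.1).compl)
    hl₀
    (fun ω n l hl => by
      obtain ⟨l₁, h₁, hl₁, y, hy⟩ := hl.exists_cons (hr ω) hs hexts (u n)
      obtain ⟨l₂, h₂, hl₂, x, hx⟩ := hl₁.exists_cons_snd (hr ω) hs (hextr ω) (v n)
      exact ⟨l₂, hl₂, List.Subset.trans h₁ h₂, ⟨y, h₂ hy⟩, x, hx⟩)
  have hmono : ∀ ω m n, m ≤ n → f m ω ⊆ f n ω := by
    intro ω m n h
    induction n, h using Nat.le_induction with
    | base => exact fun _ => id
    | succ n _ ih => exact List.Subset.trans ih (hfT n ω).1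
  let R : Ω → P → Q → Prop := fun ω x y => ∃ n, (x, y) ∈ f n ω
  have hR : ∀ ω x y x' y', R ω x y → R ω x' y' →
      (x = x' ↔ y = y') ∧ (r ω x x' ↔ s y y') ∧ c x = d y := by
    rintro ω x y x' y' ⟨n, h⟩ ⟨n', h'⟩
    replace h := hmono ω _ _ (le_max_left n n') h
    replace h' := hmono ω _ _ (le_max_right n n') h'
    exact ⟨(hfI _ ω).fst_eq_iff (hr ω) hs h h', (hfI _ ω _ h).2 _ h', (hfI _ ω _ h).1⟩
  have hR₁ : ∀ ω x, ∃ y, R ω x y := by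
    intro ω x
    obtain ⟨n, rfl⟩ := hu x
    obtain ⟨y, hy⟩ := (hfT n ω).2.1
    exact ⟨y, n + 1, hy⟩
  have hR₂ : ∀ ω y, ∃ x, R ω x y := by
    intro ω y
    obtain ⟨n, rfl⟩ := hv y
    obtain ⟨x, hx⟩ := (hfT n ω).2.2
    exact ⟨x, n + 1, hx⟩
  choose g hg using hR₁
  choose g' hg' using hR₂
  have hgR : ∀ ω x y, g ω x = y ↔ R ω x y := fun ω x y =>
    ⟨fun e => e ▸ hg ω x, fun h => (hR ω _ _ _ _ (hg ω x) h).1.1 rfl⟩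
  refine ⟨fun ω => ⟨g ω, g' ω, fun x => (hR ω _ _ _ _ (hg' ω _) (hg ω x)).1.2 rfl,
    fun y => (hR ω _ _ _ _ (hg ω _) (hg' ω y)).1.1 rfl⟩, fun x y => ?_, fun ω x y =>
    (hR ω _ _ _ _ (hg ω x) (hg ω y)).2.1, fun ω x => (hR ω _ _ _ _ (hg ω x) (hg ω x)).2.2.symm,
    fun ω p hp => (hgR ω _ _).2 ⟨0, by rwa [hf₀]⟩⟩
  simp only [Equiv.coe_fn_mk, hgR, R, Set.ofPred_exists]
  refine .iUnion fun n => ?_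
  have : {ω | (x, y) ∈ f n ω} = ⋃ l, ⋃ (_ : (x, y) ∈ l), {ω | f n ω = l} := by
    ext ω
    simp
  rw [this]
  exact .iUnion fun l => .iUnion fun _ => hfm n l

/-! ### The extension property and the generic partial order -/

/-- The witness is a new term whose index is at least every size occurring in `I`. It is then larger
than each member of `I`, so a comparison with such a member would have to factor through `L` or `U`,
which the hypotheses exclude. -/
theorem FreeTerm.hasExtensionProperty {r : ℕ → ℕ → Prop} (hr : IsPartialOrder ℕ r) :
    HasExtensionProperty (FreeTerm.Le r) FreeTerm.color := by
  intro L U I hL hU hI hLU hLI hUI i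
  obtain ⟨p, l, -, rfl⟩ := hL.fin_param
  obtain ⟨q, u, -, rfl⟩ := hU.fin_param
  have hv : ∀ a b, FreeTerm.Lt r (l a) (u b) := fun a b =>
    (FreeTerm.lt_iff_le_and_ne hr).2 (hLU _ ⟨a, rfl⟩ _ ⟨b, rfl⟩)
  obtain ⟨N, hN⟩ : ∃ N : ℕ, ∀ x ∈ I, x.size ≤ N := by
    obtain ⟨N, hN⟩ := (hI.image FreeTerm.size).bddAbove
    exact ⟨N, fun x hx => hN ⟨x, hx, rfl⟩⟩
  have hsize : ∀ x ∈ I, x.size < (FreeTerm.new l u i N).size := by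
    intro x hx
    have := hN x hx
    simp only [FreeTerm.size, Int.natAbs_natCast]
    omega
  refine ⟨.new l u i N, rfl, ?_, ?_, fun x hx => ⟨?_, ?_⟩⟩
  · rintro _ ⟨a, rfl⟩
    exact (FreeTerm.lt_iff_le_and_ne hr).1 (.lower hv a)
  · rintro _ ⟨b, rfl⟩
    exact (FreeTerm.lt_iff_le_and_ne hr).1 (.upper hv b)
  · rintro (rfl | h)
    · exact lt_irrefl _ (hsize _ hx)
    · obtain ⟨a, ha⟩ := h.exists_le_lower (hsize x hx).le
      exact hLI x hx _ ⟨a, rfl⟩ ha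
  · rintro (rfl | h)
    · exact lt_irrefl _ (hsize _ hx)
    · obtain ⟨b, hb⟩ := h.exists_upper_le (hsize x hx).le
      exact hUI x hx _ ⟨b, rfl⟩ hb

theorem HasExtensionProperty.uncolored {P C : Type*} [Nonempty C] {r : P → P → Prop} {c : P → C}
    (h : HasExtensionProperty r c) : HasExtensionProperty r fun _ => () := by
  intro L U I hL hU hI hLU hLI hUI _
  obtain ⟨z, -, hz⟩ := h L U I hL hU hI hLU hLI hUI (Classical.arbitrary C)
  exact ⟨z, rfl, hz⟩

theorem HasExtensionProperty.nonempty {P C : Type*} [Nonempty C] {r : P → P → Prop} {c : P → C}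
    (h : HasExtensionProperty r c) : Nonempty P := by
  obtain ⟨z, -⟩ := h ∅ ∅ ∅ Set.finite_empty Set.finite_empty Set.finite_empty (by simp) (by simp)
    (by simp) (Classical.arbitrary C)
  exact ⟨z⟩

theorem HasExtensionProperty.isOrderDense {P C : Type*} [PartialOrder P] {c : P → C}
    (h : HasExtensionProperty (· ≤ ·) c) (i : C) : IsOrderDense {x | c x = i} := by
  intro x y hxy
  obtain ⟨z, hz, hx, hy, -⟩ := h {x} {y} ∅ (Set.finite_singleton _) (Set.finite_singleton _)
    Set.finite_empty (by simpa using ⟨hxy.le, hxy.ne⟩) (by simp) (by simp) i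
  exact ⟨z, hz, lt_of_le_of_ne (hx x rfl).1 (hx x rfl).2, lt_of_le_of_ne (hy y rfl).1 (hy y rfl).2⟩

theorem isPartialOrder_le (P : Type*) [PartialOrder P] : IsPartialOrder P (· ≤ ·) :=
  inferInstance

/-- Universality needs only the forth direction, one point at a time; homogeneity is back-and-forth
started from the given finite map, with a one-point parameter space. -/
theorem HasExtensionProperty.isGenericPartialOrder {P C : Type*} [PartialOrder P] [Countable P]
    [Nonempty C] {c : P → C} (h : HasExtensionProperty (· ≤ ·) c) : IsGenericPartialOrder P := by
  have hP := h.nonempty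
  replace h := h.uncolored
  refine ⟨inferInstance, fun A _ _ => ?_, fun s hs f => ?_⟩
  · have key : ∀ t : List A, ∃ l : List (A × P), IsPartialIso (· ≤ ·) (fun _ => ()) (· ≤ ·)
        (fun _ => ()) l ∧ ∀ a ∈ t, ∃ y, (a, y) ∈ l := by
      intro t
      induction t with
      | nil => exact ⟨[], by simp [IsPartialIso], by simp⟩
      | cons a t ih =>
        obtain ⟨l, hl, hlt⟩ := ih
        obtain ⟨l', hll', hl', hy⟩ :=
          hl.exists_cons (isPartialOrder_le A) (isPartialOrder_le P) h a
        refine ⟨l', hl', fun b hb => ?_⟩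
        rcases List.mem_cons.1 hb with rfl | hb
        · exact hy
        · obtain ⟨y, hy⟩ := hlt b hb
          exact ⟨y, hll' hy⟩
    have := Fintype.ofFinite A
    obtain ⟨l, hl, hlt⟩ := key Finset.univ.toList
    choose f hf using fun a => hlt a (Finset.mem_toList.2 (Finset.mem_univ a))
    exact ⟨OrderEmbedding.ofMapLEIff f fun a b => ((hl _ (hf a)).2 _ (hf b)).symm⟩
  · have := hs.fintype
    obtain ⟨g, -, hg, -, hgf⟩ := exists_measurable_equiv (Ω := Unit) (P := P) (Q := P)
      (r := fun _ => (· ≤ ·)) (s := (· ≤ ·)) (c := fun _ => ()) (d := fun _ => ())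
      (fun x y => .const _) (fun _ => isPartialOrder_le P) (isPartialOrder_le P) (fun _ => h) h
      ((Finset.univ : Finset s).toList.map fun x : s => ((x : P), f x))
      (fun _ => by
        intro p hp
        obtain ⟨x, -, rfl⟩ := List.mem_map.1 hp
        refine ⟨rfl, fun q hq => ?_⟩
        obtain ⟨y, -, rfl⟩ := List.mem_map.1 hq
        exact f.le_iff_le.symm)
    exact ⟨⟨g (), (hg () _ _).symm⟩, fun x => hgf () ((x : P), f x)
      (List.mem_map.2 ⟨x, by simp, rfl⟩)⟩

theorem IsGenericPartialOrder.infinite {P : Type*} [PartialOrder P]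
    (h : IsGenericPartialOrder P) : Infinite P := by
  by_contra hP
  have := not_infinite_iff_finite.1 hP
  obtain ⟨f⟩ := h.universal (Fin (Nat.card P + 1))
  have := Nat.card_le_card_of_injective f f.injective
  simp at this

theorem IsGenericPartialOrder.hasExtensionProperty {P C : Type*} [PartialOrder P]
    (h : IsGenericPartialOrder P) {c : P → C} (hc : ∀ i, IsOrderDense {x | c x = i}) :
    HasExtensionProperty (· ≤ ·) c := by
  have := h.countable
  have := h.infinite
  obtain ⟨e⟩ : Nonempty (P ≃ ℕ) := nonempty_equiv_of_countable
  let r : ℕ → ℕ → Prop := fun m n => e.symm m ≤ e.symm n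
  have hr : IsPartialOrder ℕ r :=
    { refl := fun _ => le_refl _
      trans := fun _ _ _ => le_trans
      antisymm := fun _ _ h h' => e.symm.injective (le_antisymm h h') }
  let B : P → FreeTerm := fun a => .base (e a)
  have hB : Function.Injective B := fun a b hab => e.injective (FreeTerm.base.inj hab)
  have hBle : ∀ a b, FreeTerm.Le r (B a) (B b) ↔ a ≤ b := by
    intro a b
    simp only [FreeTerm.Le, FreeTerm.lt_base_base, B, r, Equiv.symm_apply_apply, ne_eq,
      FreeTerm.base.injEq, e.injective.eq_iff]
    exact ⟨by rintro (rfl | h); exacts [le_rfl, h.1], fun h => by tauto⟩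
  -- Without colors: the required one-point extension of the finite suborder `W` exists among the
  -- free terms over `P`. Universality embeds it in `P`, and homogeneity moves the copy of `W` back
  -- onto `W`.
  have h₀ : HasExtensionProperty (· ≤ ·) fun _ : P => () := by
    intro L U I hL hU hI hLU hLI hUI _
    obtain ⟨z, -, hzL, hzU, hzI⟩ := FreeTerm.hasExtensionProperty hr (B '' L) (B '' U) (B '' I)
      (hL.image B) (hU.image B) (hI.image B)
      (by
        rintro _ ⟨a, ha, rfl⟩ _ ⟨b, hb, rfl⟩
        exact ⟨(hBle a b).2 (hLU a ha b hb).1, hB.ne (hLU a ha b hb).2⟩)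
      (by
        rintro _ ⟨x, hx, rfl⟩ _ ⟨a, ha, rfl⟩
        exact fun h => hLI x hx a ha ((hBle _ _).1 h))
      (by
        rintro _ ⟨x, hx, rfl⟩ _ ⟨b, hb, rfl⟩
        exact fun h => hUI x hx b hb ((hBle _ _).1 h)) 0
    let W : Set P := L ∪ U ∪ I
    have hW : W.Finite := (hL.union hU).union hI
    let A : Set FreeTerm := insert z (B '' W)
    have hA : A.Finite := (hW.image B).insert z
    have := hA.to_subtype
    let : PartialOrder A :=
      { le := fun x y => FreeTerm.Le r x y
        le_refl := fun _ => Or.inl rfl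
        le_trans := fun _ _ _ => FreeTerm.Le.trans hr
        le_antisymm := fun x y h h' =>
          Subtype.ext ((FreeTerm.isPartialOrder_le hr).antisymm _ _ h h') }
    obtain ⟨j⟩ := h.universal A
    have hBA : ∀ a : W, B a ∈ A := fun a => Set.mem_insert_of_mem _ ⟨a, a.2, rfl⟩
    obtain ⟨g, hg⟩ := h.homogeneous W hW
      (OrderEmbedding.ofMapLEIff (fun a : W => j ⟨B a, hBA a⟩) fun a b => by
        rw [j.le_iff_le]
        exact hBle a b)
    have hgz : ∀ a ∈ W, (a ≤ g.symm (j ⟨z, Set.mem_insert _ _⟩) ↔ FreeTerm.Le r (B a) z) ∧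
        (g.symm (j ⟨z, Set.mem_insert _ _⟩) ≤ a ↔ FreeTerm.Le r z (B a)) := by
      intro a ha
      have := hg ⟨a, ha⟩
      simp only [OrderEmbedding.coe_ofMapLEIff] at this
      rw [OrderIso.le_symm_apply, OrderIso.symm_apply_le, this, j.le_iff_le, j.le_iff_le]
      exact ⟨Iff.rfl, Iff.rfl⟩
    refine ⟨g.symm (j ⟨z, Set.mem_insert _ _⟩), rfl, fun a ha => ?_, fun b hb => ?_,
      fun x hx => ?_⟩
    · have hz := hzL _ ⟨a, ha, rfl⟩
      have hw := hgz a (Or.inl (Or.inl ha))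
      refine ⟨hw.1.2 hz.1, fun e => hz.2 ?_⟩
      exact (FreeTerm.isPartialOrder_le hr).antisymm _ _ hz.1 (hw.2.1 e.ge)
    · have hz := hzU _ ⟨b, hb, rfl⟩
      have hw := hgz b (Or.inl (Or.inr hb))
      refine ⟨hw.2.2 hz.1, fun e => hz.2 ?_⟩
      exact (FreeTerm.isPartialOrder_le hr).antisymm _ _ hz.1 (hw.1.1 e.ge)
    · have hz := hzI _ ⟨x, hx, rfl⟩
      have hw := hgz x (Or.inr hx)
      exact ⟨fun e => hz.1 (hw.1.1 e), fun e => hz.2 (hw.2.1 e)⟩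
  intro L U I hL hU hI hLU hLI hUI i
  obtain ⟨z₀, -, hL₀, hU₀, hI₀⟩ := h₀ L U I hL hU hI hLU hLI hUI ()
  -- A second solution above `z₀`. Every point between two solutions is again a solution, so density
  -- of the color class finishes.
  obtain ⟨z₁, -, hL₁, hU₁, hI₁⟩ := h₀ {z₀} U I (Set.finite_singleton _) hU hI
    (by rintro _ rfl; exact hU₀) (by rintro x hx _ rfl; exact (hI₀ x hx).1) hUI ()
  have h₀₁ : z₀ < z₁ := lt_of_le_of_ne (hL₁ z₀ rfl).1 (hL₁ z₀ rfl).2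
  obtain ⟨z, hz, hz₀, hz₁⟩ := hc i z₀ z₁ h₀₁
  refine ⟨z, hz, fun a ha => ?_, fun b hb => ?_, fun x hx => ⟨fun e => ?_, fun e => ?_⟩⟩
  · have := lt_of_le_of_lt (hL₀ a ha).1 hz₀
    exact ⟨this.le, this.ne⟩
  · have := lt_of_lt_of_le hz₁ (hU₁ b hb).1
    exact ⟨this.le, this.ne⟩
  · exact (hI₁ x hx).1 (le_trans e hz₁.le)
  · exact (hI₀ x hx).2 (le_trans hz₀.le e)

/-- The free extension of any partial order on ℕ would serve; the usual order is used, and the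
result is transported to ℕ. -/
theorem exists_isGenericShuffledPartialOrder :
    ∃ G : Digraph ℕ, IsGenericShuffledPartialOrder G := by
  have hr : IsPartialOrder ℕ (· ≤ ·) := inferInstance
  have : Infinite FreeTerm := Infinite.of_injective FreeTerm.base fun _ _ => FreeTerm.base.inj
  obtain ⟨e⟩ : Nonempty (ℕ ≃ FreeTerm) := nonempty_equiv_of_countable
  let po : PartialOrder FreeTerm :=
    { le := FreeTerm.Le (· ≤ ·)
      le_refl := fun _ => Or.inl rfl
      le_trans := fun _ _ _ => FreeTerm.Le.trans hr
      le_antisymm := (FreeTerm.isPartialOrder_le hr).antisymm }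
  let po' : PartialOrder ℕ := PartialOrder.lift e e.injective
  have h : HasExtensionProperty po'.le (FreeTerm.color ∘ e) := by
    intro L U I hL hU hI hLU hLI hUI i
    obtain ⟨z, hz, hzL, hzU, hzI⟩ := FreeTerm.hasExtensionProperty hr (e '' L) (e '' U) (e '' I)
      (hL.image e) (hU.image e) (hI.image e)
      (by
        rintro _ ⟨a, ha, rfl⟩ _ ⟨b, hb, rfl⟩
        exact ⟨(hLU a ha b hb).1, e.injective.ne (hLU a ha b hb).2⟩)
      (by rintro _ ⟨x, hx, rfl⟩ _ ⟨a, ha, rfl⟩; exact hLI x hx a ha)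
      (by rintro _ ⟨x, hx, rfl⟩ _ ⟨b, hb, rfl⟩; exact hUI x hx b hb) i
    obtain ⟨y, rfl⟩ := e.surjective z
    refine ⟨y, hz, fun a ha => ?_, fun b hb => ?_, fun x hx => hzI _ ⟨x, hx, rfl⟩⟩
    · exact ⟨(hzL _ ⟨a, ha, rfl⟩).1, ne_of_apply_ne e (hzL _ ⟨a, ha, rfl⟩).2⟩
    · exact ⟨(hzU _ ⟨b, hb, rfl⟩).1, ne_of_apply_ne e (hzU _ ⟨b, hb, rfl⟩).2⟩
  exact ⟨@shuffledDigraph ℕ po' _, po', FreeTerm.color ∘ e,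
    @HasExtensionProperty.isGenericPartialOrder _ _ po' _ _ _ h,
    @HasExtensionProperty.isOrderDense _ _ po' _ h, rfl⟩

/-! ### From partial orders to conjugacy -/

/-- As the vertex set is countable and discrete, the Borel sets of the pointwise topology are
generated by the conditions φ v = w. -/
theorem measurable_of_measurableSet_apply_eq {Ω V : Type*} [MeasurableSpace Ω] [Countable V]
    {G : Digraph V} {f : Ω → DigraphAut G} (h : ∀ v w, MeasurableSet {ω | f ω v = w}) :
    Measurable f := by
  let τ : TopologicalSpace V := ⊥
  have : DiscreteTopology V := ⟨rfl⟩
  let : MeasurableSpace V := ⊤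
  have e : digraphAutMeasurableSpace G =
      MeasurableSpace.comap (fun (φ : DigraphAut G) (x : V) => φ x) MeasurableSpace.pi := by
    rw [BorelSpace.measurable_eq (α := V → V)]
    exact borel_comap
  rw [e]
  refine measurable_comap_iff.2 (measurable_pi_iff.2 fun v => measurable_to_countable' fun w => ?_)
  exact h v w

theorem measurableSet_apply_eq {V : Type*} (G : Digraph V) (v w : V) :
    MeasurableSet {φ : DigraphAut G | φ v = w} := by
  let τ : TopologicalSpace V := ⊥
  let := digraphAutTopology G
  have : BorelSpace (DigraphAut G) := ⟨rfl⟩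
  have h : IsOpen ((fun x : V → V => x v) ⁻¹' {w}) :=
    (@isOpen_discrete V ⊥ (@DiscreteTopology.mk V ⊥ rfl) {w}).preimage (continuous_apply v)
  exact IsOpen.measurableSet (isOpen_induced h)

theorem adj_iff_of_orderIso {V : Type*} [PartialOrder V] {c : V → ZMod 3} (g : V ≃ V)
    (hg : ∀ x y, g x ≤ g y ↔ x ≤ y) (hc : ∀ x, c (g x) = c x) (x y : V) :
    (shuffledDigraph c).Adj (g x) (g y) ↔ (shuffledDigraph c).Adj x y := by
  simp only [shuffledDigraph, hc, hg, lt_iff_le_not_ge]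

theorem partialOrderIso_reducible_conjugacy {V : Type*} {G : Digraph V}
    (hG : IsGenericShuffledPartialOrder G) : BorelReducible partialOrderIso (conjugacy G) := by
  obtain ⟨po, c, hgen, hdense, rfl⟩ := hG
  have := hgen.countable
  have hext := hgen.hasExtensionProperty hdense
  have := hext.nonempty
  have : Nonempty FreeTerm := ⟨.base 0⟩
  have hm : ∀ m n : ℕ, MeasurableSet {X : CodedPartialOrder | X.1 m n} := fun m n =>
    measurableSet_setOfPred.2
      ((measurable_pi_apply n).comp ((measurable_pi_apply m).comp measurable_subtype_coe))
  obtain ⟨h, hhm, hle, hc, -⟩ := exists_measurable_equiv (Ω := CodedPartialOrder)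
    (r := fun X => FreeTerm.Le X.1) (s := ((· ≤ ·) : V → V → Prop)) (c := FreeTerm.color) (d := c)
    (FreeTerm.measurableSet_le hm) (fun X => FreeTerm.isPartialOrder_le X.2) (isPartialOrder_le V)
    (fun X => FreeTerm.hasExtensionProperty X.2) hext [] (by simp [IsPartialIso])
  let φ : Equiv.Perm FreeTerm := FreeTerm.mapEquiv 1 1
  have hφ : ∀ (X : CodedPartialOrder) x y, FreeTerm.Le X.1 (φ x) (φ y) ↔ FreeTerm.Le X.1 x y :=
    fun X => FreeTerm.le_mapEquiv 1 1 fun _ _ => Iff.rfl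
  let f : CodedPartialOrder → DigraphAut (shuffledDigraph c) := fun X =>
    ⟨((h X).symm.trans φ).trans (h X), adj_iff_of_orderIso _
      (fun x y => by simp [← hle, hφ, hle]) (fun x => by
        simp only [Equiv.trans_apply, hc]
        rw [show (φ ((h X).symm x)).color = _ from FreeTerm.color_map _ _ _, ← hc X,
          Equiv.apply_symm_apply]) _ _⟩
  have hf : ∀ X x, f X (h X x) = h X (φ x) := fun X x => by simp [f]
  have hfix : ∀ X x, f X (h X x) = h X x ↔ ∃ n, x = .base n := by
    intro X x
    rw [hf, (h X).injective.eq_iff]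
    exact FreeTerm.mapEquiv_eq_self_iff x
  -- Base points share color 0, so only the same-color clause of the shuffle applies to them.
  have hadj : ∀ X m n, (shuffledDigraph c).Adj (h X (.base m)) (h X (.base n)) ↔
      X.1 m n ∧ m ≠ n := by
    intro X m n
    simp only [shuffledDigraph, hc, FreeTerm.color, true_and,
      show ¬ ((0 : ZMod 3) = 0 + 1) by decide, false_and, or_false]
    rw [← FreeTerm.lt_base_base, FreeTerm.lt_iff_le_and_ne X.2, hle, ← (h X).injective.ne_iff]
    exact lt_iff_le_and_ne
  refine ⟨f, measurable_of_measurableSet_apply_eq fun v w => ?_, fun X Y => ⟨?_, fun hconj => ?_⟩⟩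
  · have : {X | f X v = w} = ⋃ x, {X | h X x = v} ∩ {X | h X (φ x) = w} := by
      ext X
      simp only [Set.mem_ofPred_eq, Set.mem_iUnion, Set.mem_inter_iff]
      constructor
      · intro e
        refine ⟨(h X).symm v, by simp, ?_⟩
        rw [← hf, Equiv.apply_symm_apply, e]
      · rintro ⟨x, rfl, rfl⟩
        exact hf X x
    rw [this]
    exact .iUnion fun x => (hhm _ _).inter (hhm _ _)
  · rintro ⟨σ⟩
    let ψ := FreeTerm.mapEquiv σ.toEquiv 0
    have hψ : ∀ x y, FreeTerm.Le Y.1 (ψ x) (ψ y) ↔ FreeTerm.Le X.1 x y :=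
      FreeTerm.le_mapEquiv _ _ fun _ _ => σ.map_rel_iff.symm
    let g : DigraphAut (shuffledDigraph c) :=
      ⟨((h X).symm.trans ψ).trans (h Y), adj_iff_of_orderIso _
        (fun x y => by simp [← hle, hψ]; simp [hle]) (fun x => by
          simp only [Equiv.trans_apply, hc]
          rw [show (ψ ((h X).symm x)).color = _ from FreeTerm.color_map _ _ _, ← hc X,
            Equiv.apply_symm_apply]) _ _⟩
    have hg : ∀ x, g (h X x) = h Y (ψ x) := fun x => by simp [g]
    refine isConj_iff.2 ⟨g, mul_inv_eq_iff_eq_mul.2 (RelIso.ext fun v => ?_)⟩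
    obtain ⟨x, rfl⟩ := (h X).surjective v
    rw [RelIso.mul_apply, RelIso.mul_apply, hf, hg, hg, hf]
    exact congrArg (h Y) (FreeTerm.mapEquiv_comm _ _)
  -- A conjugator maps the fixed points of `f X` onto those of `f Y`, that is, base points onto base
  -- points.
  · obtain ⟨g, hg⟩ := isConj_iff.1 (show IsConj (f X) (f Y) from hconj)
    rw [mul_inv_eq_iff_eq_mul] at hg
    have hgf : ∀ v, g (f X v) = f Y (g v) := fun v => by
      simpa only [RelIso.mul_apply] using congrArg (fun k : DigraphAut _ => k v) hg
    have h₁ : ∀ m, ∃ n, g (h X (.base m)) = h Y (.base n) := by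
      intro m
      obtain ⟨y, hy⟩ := (h Y).surjective (g (h X (.base m)))
      have := hgf (h X (.base m))
      rw [(hfix X _).2 ⟨m, rfl⟩, ← hy] at this
      obtain ⟨n, rfl⟩ := (hfix Y y).1 this.symm
      exact ⟨n, hy.symm⟩
    have h₂ : ∀ n, ∃ m, g (h X (.base m)) = h Y (.base n) := by
      intro n
      obtain ⟨v, hv⟩ := g.surjective (h Y (.base n))
      obtain ⟨x, rfl⟩ := (h X).surjective v
      have := hgf (h X x)
      rw [hv, (hfix Y _).2 ⟨n, rfl⟩, ← hv] at this
      obtain ⟨m, rfl⟩ := (hfix X x).1 (g.injective this)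
      exact ⟨m, hv⟩
    choose σ hσ using h₁
    have hσi : Function.Injective σ := fun m m' e => by
      have := (hσ m).trans ((congrArg (fun k => h Y (.base k)) e).trans (hσ m').symm)
      exact FreeTerm.base.inj ((h X).injective (g.injective this))
    have hσs : Function.Surjective σ := fun n => by
      obtain ⟨m, hm⟩ := h₂ n
      exact ⟨m, FreeTerm.base.inj ((h Y).injective ((hσ m).symm.trans hm))⟩
    refine ⟨⟨Equiv.ofBijective σ ⟨hσi, hσs⟩, fun {m n} => ?_⟩⟩
    have key := g.map_rel_iff (a := h X (.base m)) (b := h X (.base n))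
    rw [hσ, hσ, hadj, hadj, hσi.ne_iff] at key
    by_cases hmn : m = n
    · subst hmn
      exact iff_of_true (Y.2.refl _) (X.2.refl _)
    · change Y.1 (σ m) (σ n) ↔ X.1 m n
      simpa [hmn] using key

/-! ### From countable structures to partial orders -/

theorem BorelReducible.trans {X Y Z : Type*} [MeasurableSpace X] [MeasurableSpace Y]
    [MeasurableSpace Z] {E : Setoid X} {F : Setoid Y} {H : Setoid Z} (h : BorelReducible E F)
    (h' : BorelReducible F H) : BorelReducible E H := by
  obtain ⟨f, hf, hf'⟩ := h
  obtain ⟨g, hg, hg'⟩ := h'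
  exact ⟨g ∘ f, hg.comp hf, fun x x' => (hf' x x').trans (hg' _ _)⟩

/-- The points of the partial order coding a structure with signature `a`: an infinite ascending
chain, the elements of the structure, the tuples to which the relation symbols apply, and the
coordinates of these tuples. -/
inductive CodingNode {ι : Type} (a : ι → ℕ) : Type
  | chain (j : ℕ) : CodingNode a
  | point (n : ℕ) : CodingNode a
  | coord (i : ι) (x : Fin (a i) → ℕ) (k : Fin (a i)) : CodingNode a
  | tuple (i : ι) (x : Fin (a i) → ℕ) : CodingNode a

namespace CodingNode

variable {ι : Type} {a : ι → ℕ}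

instance [Countable ι] : Countable (CodingNode a) := by
  let f : ℕ ⊕ ℕ ⊕ (Σ i, (Fin (a i) → ℕ) × Fin (a i)) ⊕ (Σ i, Fin (a i) → ℕ) → CodingNode a
    | .inl j => chain j
    | .inr (.inl n) => point n
    | .inr (.inr (.inl t)) => coord t.1 t.2.1 t.2.2
    | .inr (.inr (.inr t)) => tuple t.1 t.2
  have hf : Function.Surjective f := by
    rintro (j | n | ⟨i, x, k⟩ | ⟨i, x⟩)
    exacts [⟨.inl j, rfl⟩, ⟨.inr (.inl n), rfl⟩, ⟨.inr (.inr (.inl ⟨i, x, k⟩)), rfl⟩,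
      ⟨.inr (.inr (.inr ⟨i, x⟩)), rfl⟩]
  exact hf.countable

instance : Infinite (CodingNode a) :=
  Infinite.of_injective chain fun _ _ => chain.inj

open Classical in
/-- The label of a node, which will be the number of chain elements below it. The label of a tuple
determines the relation symbol and whether the relation holds. -/
noncomputable def label (e : ι → ℕ) (M : CodedStructure a) : CodingNode a → ℕ
  | chain j => j
  | point _ => 0
  | coord _ _ k => 2 * k + 1
  | tuple i x => 2 * Nat.pair (a i) (Nat.pair (e i) (if M i x then 1 else 0)) + 2

/-- The strict order on the nodes. -/
def Lt (e : ι → ℕ) (M : CodedStructure a) : CodingNode a → CodingNode a → Prop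
  | chain j, y => j < label e M y
  | point n, coord _ x k => x k = n
  | point n, tuple _ x => ∃ k, x k = n
  | coord i x _, tuple i' x' => (⟨i, x⟩ : Σ i, Fin (a i) → ℕ) = ⟨i', x'⟩
  | _, _ => False

/-- The reflexive closure of `Lt`. -/
def Le (e : ι → ℕ) (M : CodedStructure a) (x y : CodingNode a) : Prop := x = y ∨ Lt e M x y

/-- The arity is part of the tuple label for this purpose: a pairing is at least its first
component, and `k < a i`. Transitivity needs it for a chain element below a coordinate. -/
theorem label_coord_le_tuple (e : ι → ℕ) (M : CodedStructure a) (i : ι) (x : Fin (a i) → ℕ)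
    (k : Fin (a i)) : label e M (coord i x k) ≤ label e M (tuple i x) := by
  classical
  have := Nat.left_le_pair (a i) (Nat.pair (e i) (if M i x then 1 else 0))
  have hk := k.2
  simp only [label]
  convert (show 2 * (k : ℕ) + 1 ≤ 2 * Nat.pair (a i) (Nat.pair (e i) (if M i x then 1 else 0)) + 2
    by omega)

theorem Lt.trans {e : ι → ℕ} {M : CodedStructure a} {x y z : CodingNode a} (h : Lt e M x y)
    (h' : Lt e M y z) : Lt e M x z := by
  rcases x with j | n | ⟨i, x, k⟩ | ⟨i, x⟩ <;> rcases y with j' | n' | ⟨i', x', k'⟩ | ⟨i', x'⟩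
  case chain.chain => exact Nat.lt_trans h h'
  case chain.point => exact absurd h (Nat.not_lt_zero _)
  case chain.coord =>
    rcases z with j'' | n'' | ⟨i'', x'', k''⟩ | ⟨i'', x''⟩
    case tuple =>
      obtain ⟨rfl, h'⟩ := Sigma.mk.inj_iff.1 h'
      obtain rfl := eq_of_heq h'
      exact lt_of_lt_of_le h (label_coord_le_tuple e M i' x' k')
    all_goals exact h'.elim
  case point.coord =>
    rcases z with j'' | n'' | ⟨i'', x'', k''⟩ | ⟨i'', x''⟩
    case tuple =>
      obtain ⟨rfl, h'⟩ := Sigma.mk.inj_iff.1 h'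
      obtain rfl := eq_of_heq h'
      exact ⟨k', h⟩
    all_goals exact h'.elim
  all_goals first | exact h.elim | (cases z <;> exact h'.elim)

theorem Lt.irrefl {e : ι → ℕ} {M : CodedStructure a} (x : CodingNode a) : ¬ Lt e M x x := by
  intro h
  cases x
  case chain => exact lt_irrefl _ h
  all_goals exact h

theorem isPartialOrder_le (e : ι → ℕ) (M : CodedStructure a) :
    IsPartialOrder (CodingNode a) (Le e M) where
  refl _ := Or.inl rfl
  trans x y z h h' := by
    rcases h with rfl | h
    · exact h'
    · rcases h' with rfl | h'
      exacts [Or.inr h, Or.inr (h.trans h')]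
  antisymm x y h h' := by
    rcases h with h | h
    · exact h
    · rcases h' with h' | h'
      · exact h'.symm
      · exact absurd (h.trans h') (Lt.irrefl x)

theorem lt_iff_le_and_ne {e : ι → ℕ} {M : CodedStructure a} {x y : CodingNode a} :
    Lt e M x y ↔ Le e M x y ∧ x ≠ y :=
  ⟨fun h => ⟨Or.inr h, by rintro rfl; exact Lt.irrefl _ h⟩, fun h => h.1.resolve_left h.2⟩

theorem measurableSet_lt (e : ι → ℕ) (x y : CodingNode a) :
    MeasurableSet {M : CodedStructure a | Lt e M x y} := by
  classical
  rcases x with j | n | ⟨i, x, k⟩ | ⟨i, x⟩ <;> rcases y with j' | n' | ⟨i', x', k'⟩ | ⟨i', x'⟩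
  case chain.tuple =>
    have h : Measurable fun M : CodedStructure a => M i' x' :=
      (measurable_pi_apply x').comp (measurable_pi_apply i')
    have hg : Measurable fun p : Prop =>
        j < 2 * Nat.pair (a i') (Nat.pair (e i') (if p then 1 else 0)) + 2 := measurable_from_top
    convert measurableSet_setOfPred.2 (hg.comp h) using 4
    simp only [Lt, label]
    congr!
  case chain.chain => exact .const (j < j')
  case chain.point => exact .const (j < 0)
  case chain.coord => exact .const (j < 2 * (k' : ℕ) + 1)
  all_goals exact .const _

/-- The action of a permutation of the elements on the nodes. -/
def map (σ : ℕ → ℕ) : CodingNode a → CodingNode a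
  | chain j => chain j
  | point n => point (σ n)
  | coord i x k => coord i (σ ∘ x) k
  | tuple i x => tuple i (σ ∘ x)

theorem map_map (σ τ : ℕ → ℕ) (x : CodingNode a) : map σ (map τ x) = map (σ ∘ τ) x := by
  cases x <;> rfl

theorem map_id (x : CodingNode a) : map id x = x := by
  cases x <;> rfl

/-- The permutation of the nodes induced by a permutation of the elements. -/
def mapEquiv (σ : Equiv.Perm ℕ) : Equiv.Perm (CodingNode a) where
  toFun := map σ
  invFun := map σ.symm
  left_inv x := by simp [map_map, map_id]
  right_inv x := by simp [map_map, map_id]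

theorem Lt.map {e : ι → ℕ} {M N : CodedStructure a} {σ : ℕ → ℕ}
    (hσ : ∀ i x, M i x ↔ N i (σ ∘ x)) {x y : CodingNode a} (h : Lt e M x y) :
    Lt e N (map σ x) (map σ y) := by
  rcases x with j | n | ⟨i, x, k⟩ | ⟨i, x⟩ <;> rcases y with j' | n' | ⟨i', x', k'⟩ | ⟨i', x'⟩
  case chain.tuple =>
    have : label e N (tuple i' (σ ∘ x')) = label e M (tuple i' x') := by
      have h₁ := hσ i' x'
      by_cases h₂ : M i' x'
      · simp only [label, if_pos h₂, if_pos (h₁.1 h₂)]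
      · simp only [label, if_neg h₂, if_neg (mt h₁.2 h₂)]
    exact lt_of_lt_of_eq h this.symm
  case point.coord => exact congrArg σ h
  case point.tuple =>
    obtain ⟨k, hk⟩ := h
    exact ⟨k, congrArg σ hk⟩
  case coord.tuple =>
    obtain ⟨rfl, h⟩ := Sigma.mk.inj_iff.1 h
    obtain rfl := eq_of_heq h
    exact rfl
  all_goals exact h

theorem le_mapEquiv {e : ι → ℕ} {M N : CodedStructure a} {σ : Equiv.Perm ℕ}
    (hσ : ∀ i x, M i x ↔ N i (fun k => σ (x k))) (x y : CodingNode a) :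
    Le e N (mapEquiv σ x) (mapEquiv σ y) ↔ Le e M x y := by
  constructor
  · rintro (h | h)
    · exact Or.inl ((mapEquiv σ).injective h)
    · have := h.map (N := M) (σ := σ.symm) fun i x => by
        rw [hσ]
        simp
      have he := (mapEquiv (a := a) σ).symm_apply_apply
      exact Or.inr ((congrArg₂ (Lt e M) (he x) (he y)).mp this)
  · rintro (rfl | h)
    · exact Or.inl rfl
    · exact Or.inr (h.map hσ)

/-- The length of the path from a node that is not in the chain down to the elements. -/
def tier : CodingNode a → ℕ
  | chain _ => 0
  | point _ => 0
  | coord _ _ _ => 1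
  | tuple _ _ => 2

theorem Lt.tier_lt {e : ι → ℕ} {M : CodedStructure a} {x y : CodingNode a} (h : Lt e M x y)
    (hx : ∀ j, x ≠ chain j) : tier x < tier y ∧ ∀ j, y ≠ chain j := by
  rcases x with j | n | ⟨i, x, k⟩ | ⟨i, x⟩ <;> rcases y with j' | n' | ⟨i', x', k'⟩ | ⟨i', x'⟩
  case chain.chain | chain.point | chain.coord | chain.tuple => exact absurd rfl (hx j)
  case point.coord | point.tuple | coord.tuple => simp [tier]
  all_goals exact h.elim

/-- Off the chain every strict ascent raises the tier, which is at most 2, and never enters the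
chain. Chain elements are thus recognizable from the order alone. -/
theorem eq_chain_of_ascending {e : ι → ℕ} {M : CodedStructure a} {f : ℕ → CodingNode a}
    (hf : ∀ n, Lt e M (f n) (f (n + 1))) : ∃ j, f 0 = chain j := by
  by_contra! h
  have key : ∀ n, n ≤ tier (f n) ∧ ∀ j, f n ≠ chain j := by
    intro n
    induction n with
    | zero => exact ⟨Nat.zero_le _, h⟩
    | succ n ih => exact ⟨lt_of_le_of_lt ih.1 ((hf n).tier_lt ih.2).1, ((hf n).tier_lt ih.2).2⟩
  have h₃ := (key 3).1
  cases hx : f 3 <;> simp [hx, tier] at h₃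

/-! ### Rigidity of the coding order -/

section iso

variable {e : ι → ℕ} {M N : CodedStructure a}

theorem exists_strictMono_chain {F : CodingNode a → CodingNode a}
    (hF : ∀ x y, Lt e M x y ↔ Lt e N (F x) (F y)) :
    ∃ g : ℕ → ℕ, StrictMono g ∧ ∀ j, F (chain j) = chain (g j) := by
  have h : ∀ j, ∃ k, F (chain j) = chain k := fun j =>
    eq_chain_of_ascending (f := fun n => F (chain (j + n)))
      fun n => (hF _ _).1 (Nat.lt_succ_self (j + n))
  choose g hg using h
  refine ⟨g, fun j k hjk => ?_, hg⟩
  have := (hF (chain j) (chain k)).1 hjk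
  rw [hg, hg] at this
  exact this

/-- The isomorphism and its inverse both act on the chain as strictly increasing maps of ℕ. Such
maps never decrease a number, and these two are mutually inverse, so both are the identity. -/
theorem iso_chain {F : Equiv.Perm (CodingNode a)} (hF : ∀ x y, Lt e M x y ↔ Lt e N (F x) (F y))
    (j : ℕ) : F (chain j) = chain j := by
  obtain ⟨g, hg, hgF⟩ := exists_strictMono_chain hF
  obtain ⟨g', hg', hgF'⟩ := exists_strictMono_chain (F := F.symm) (e := e) (M := N) (N := M)
    fun x y => by rw [hF, F.apply_symm_apply, F.apply_symm_apply]
  have h : g' (g j) = j := by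
    have := hgF' (g j)
    rw [← hgF, F.symm_apply_apply] at this
    exact (chain.inj this).symm
  rw [hgF]
  exact congrArg chain (le_antisymm (hg'.le_apply.trans_eq h) hg.le_apply)

/-- The label counts the chain elements below a node, and those are fixed. -/
theorem iso_label {F : Equiv.Perm (CodingNode a)} (hF : ∀ x y, Lt e M x y ↔ Lt e N (F x) (F y))
    (x : CodingNode a) : label e N (F x) = label e M x := by
  refine eq_of_forall_lt_iff fun j => ?_
  have := hF (chain j) x
  rw [iso_chain hF] at this
  exact this.symm

theorem iso_ne_chain {F : Equiv.Perm (CodingNode a)}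
    (hF : ∀ x y, Lt e M x y ↔ Lt e N (F x) (F y)) {x : CodingNode a} (hx : ∀ j, x ≠ chain j)
    (j : ℕ) : F x ≠ chain j := fun h => by
  rw [← iso_chain hF j] at h
  exact hx j (F.injective h)

theorem iso_point {F : Equiv.Perm (CodingNode a)} (hF : ∀ x y, Lt e M x y ↔ Lt e N (F x) (F y))
    (n : ℕ) : ∃ m, F (point n) = point m := by
  have h := iso_label hF (point n)
  have h' := iso_ne_chain hF (x := point n) (by simp)
  cases hx : F (point n) with
  | chain j => exact absurd hx (h' j)
  | point m => exact ⟨m, rfl⟩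
  | coord i x k => simp [hx, label] at h
  | tuple i x => simp [hx, label] at h

/-- Off the chain, points have label 0, coordinates odd labels and tuples positive even ones.
Injectivity of the pairing and of `e` then recovers the symbol and the truth value. -/
theorem iso_tuple (he : Function.Injective e) {F : Equiv.Perm (CodingNode a)}
    (hF : ∀ x y, Lt e M x y ↔ Lt e N (F x) (F y)) (i : ι) (x : Fin (a i) → ℕ) :
    ∃ x', F (tuple i x) = tuple i x' ∧ (M i x ↔ N i x') := by
  have h := iso_label hF (tuple i x)
  have h' := iso_ne_chain hF (x := tuple i x) (by simp)
  cases hx : F (tuple i x) with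
  | chain j => exact absurd hx (h' j)
  | point m => simp [hx, label] at h
  | coord i' x' k =>
    simp only [hx, label] at h
    omega
  | tuple i' x' =>
    simp only [hx, label, Nat.add_right_cancel_iff, Nat.mul_right_inj two_ne_zero,
      Nat.pair_eq_pair] at h
    obtain ⟨-, hi, ht⟩ := h
    obtain rfl := he hi
    refine ⟨x', rfl, ?_⟩
    by_cases h₁ : M i' x <;> by_cases h₂ : N i' x' <;> simp_all

/-- The image lies below the image tuple and has the same odd label, which determines the position.
-/
theorem iso_coord {F : Equiv.Perm (CodingNode a)} (hF : ∀ x y, Lt e M x y ↔ Lt e N (F x) (F y))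
    {i : ι} {x x' : Fin (a i) → ℕ} (hx : F (tuple i x) = tuple i x') (k : Fin (a i)) :
    F (coord i x k) = coord i x' k := by
  have h := iso_label hF (coord i x k)
  have h' := iso_ne_chain hF (x := coord i x k) (by simp)
  have hlt := (hF (coord i x k) (tuple i x)).1 rfl
  rw [hx] at hlt
  cases hy : F (coord i x k) with
  | chain j => exact absurd hy (h' j)
  | point m => simp [hy, label] at h
  | coord i'' x'' k'' =>
    rw [hy] at hlt h
    obtain ⟨rfl, hlt⟩ := Sigma.mk.inj_iff.1 hlt
    obtain rfl := eq_of_heq hlt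
    simp only [label] at h
    exact congrArg _ (Fin.ext (by omega))
  | tuple i'' x'' =>
    rw [hy] at h
    simp only [label] at h
    omega

theorem codedStructureIso_of_iso (he : Function.Injective e) (F : Equiv.Perm (CodingNode a))
    (hF : ∀ x y, Le e M x y ↔ Le e N (F x) (F y)) : codedStructureIso a M N := by
  replace hF : ∀ x y, Lt e M x y ↔ Lt e N (F x) (F y) := fun x y => by
    rw [lt_iff_le_and_ne, lt_iff_le_and_ne, hF, F.injective.ne_iff]
  have hF' : ∀ x y, Lt e N x y ↔ Lt e M (F.symm x) (F.symm y) := fun x y => by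
    rw [hF, F.apply_symm_apply, F.apply_symm_apply]
  choose σ hσ using iso_point hF
  choose τ hτ using iso_point hF'
  let s : Equiv.Perm ℕ :=
    { toFun := σ
      invFun := τ
      left_inv := fun n => by
        have := hτ (σ n)
        rw [← hσ, F.symm_apply_apply] at this
        exact (point.inj this).symm
      right_inv := fun n => by
        have := hσ (τ n)
        rw [← hτ, F.apply_symm_apply] at this
        exact (point.inj this).symm }
  refine ⟨s, fun i x => ?_⟩
  obtain ⟨x', hx', hMN⟩ := iso_tuple he hF i x
  -- The k-th entry of a tuple is read off as the point below its k-th coordinate node.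
  have : x' = fun k => s (x k) := funext fun k => by
    have := (hF (point (x k)) (coord i x k)).1 rfl
    rw [hσ, iso_coord hF hx'] at this
    exact this
  rw [hMN, this]

end iso

end CodingNode

theorem isoOnClass_reducible_partialOrderIso {ι : Type} [Countable ι] (a : ι → ℕ)
    (C : Set (CodedStructure a)) : BorelReducible (isoOnClass a C) partialOrderIso := by
  obtain ⟨e, he⟩ := Countable.exists_injective_nat ι
  obtain ⟨u⟩ : Nonempty (ℕ ≃ CodingNode a) := nonempty_equiv_of_countable
  have hpo : ∀ M : CodedStructure a,
      IsPartialOrder ℕ fun m n => CodingNode.Le e M (u m) (u n) := fun M =>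
    { refl := fun _ => (CodingNode.isPartialOrder_le e M).refl _
      trans := fun _ _ _ => (CodingNode.isPartialOrder_le e M).trans _ _ _
      antisymm := fun _ _ h h' =>
        u.injective ((CodingNode.isPartialOrder_le e M).antisymm _ _ h h') }
  refine ⟨fun M => ⟨_, hpo M⟩, ?_, fun M N => ⟨?_, ?_⟩⟩
  · refine Measurable.subtype_mk (measurable_pi_iff.2 fun m => measurable_pi_iff.2 fun n => ?_)
    refine measurableSet_setOfPred.1 (measurable_subtype_coe
      (t := {M | CodingNode.Le e M (u m) (u n)}) ?_)
    exact (MeasurableSet.const _).union (CodingNode.measurableSet_lt e _ _)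
  · rintro ⟨σ, hσ⟩
    exact ⟨⟨(u.trans (CodingNode.mapEquiv σ)).trans u.symm, fun {m n} => by
      simpa using CodingNode.le_mapEquiv hσ (u m) (u n)⟩⟩
  · rintro ⟨F⟩
    refine CodingNode.codedStructureIso_of_iso he ((u.symm.trans F.toEquiv).trans u) fun x y => ?_
    have := F.map_rel_iff (a := u.symm x) (b := u.symm y)
    simpa using this.symm

/-! ### From conjugacy to countable structures -/

/-- An isomorphism between two codes preserves edges, hence is an automorphism of `G`, and carries
one graph to the other, hence conjugates. -/
theorem conjugacy_reducible_isoOnClass {V : Type*} [Countable V] [Infinite V] (G : Digraph V) :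
    BorelReducible (conjugacy G) (isoOnClass (fun _ : Bool => 2) Set.univ) := by
  obtain ⟨e⟩ : Nonempty (V ≃ ℕ) := nonempty_equiv_of_countable
  let f : DigraphAut G → CodedStructure fun _ : Bool => 2 := fun φ b x =>
    if b then G.Adj (e.symm (x 0)) (e.symm (x 1)) else φ (e.symm (x 0)) = e.symm (x 1)
  refine ⟨fun φ => ⟨f φ, trivial⟩, ?_, fun φ ψ => ⟨fun h => ?_, ?_⟩⟩
  · refine Measurable.subtype_mk (measurable_pi_iff.2 fun b => measurable_pi_iff.2 fun x => ?_)
    refine measurableSet_setOfPred.1 ?_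
    cases b
    · simpa [f] using measurableSet_apply_eq G (e.symm (x 0)) (e.symm (x 1))
    · exact .const _
  · obtain ⟨g, hg⟩ := isConj_iff.1 (show IsConj φ ψ from h)
    rw [mul_inv_eq_iff_eq_mul] at hg
    have hgf : ∀ v, g (φ v) = ψ (g v) := fun v => by
      simpa only [RelIso.mul_apply] using congrArg (fun k : DigraphAut _ => k v) hg
    refine ⟨(e.symm.trans g.toEquiv).trans e, fun b x => ?_⟩
    cases b
    · simp [f, ← hgf]
    · simpa [f] using g.map_rel_iff.symm
  · rintro ⟨σ, hσ⟩
    have h₁ : ∀ v w, G.Adj v w ↔ G.Adj (e.symm (σ (e v))) (e.symm (σ (e w))) := fun v w => by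
      simpa [f] using hσ true ![e v, e w]
    have h₂ : ∀ v w, φ v = w ↔ ψ (e.symm (σ (e v))) = e.symm (σ (e w)) := fun v w => by
      simpa [f] using hσ false ![e v, e w]
    let g : DigraphAut G := ⟨(e.trans σ).trans e.symm, fun {v w} => (h₁ v w).symm⟩
    refine isConj_iff.2 ⟨g, mul_inv_eq_iff_eq_mul.2 (RelIso.ext fun v => ?_)⟩
    exact ((h₂ v (φ v)).1 rfl).symm

theorem mainTheorem3 :
    (∃ G : Digraph ℕ, IsGenericShuffledPartialOrder G) ∧
    ∀ (V : Type*) (G : Digraph V), IsGenericShuffledPartialOrder G →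
      BorelReducible partialOrderIso (conjugacy G) ∧ IsBorelComplete (conjugacy G) := by
  refine ⟨exists_isGenericShuffledPartialOrder, fun V G hG => ?_⟩
  have h := partialOrderIso_reducible_conjugacy hG
  refine ⟨h, ⟨Bool, inferInstance, fun _ => 2, Set.univ, ⟨.univ, fun _ _ _ _ => trivial⟩, ?_⟩,
    fun ι _ a C _ => (isoOnClass_reducible_partialOrderIso a C).trans h⟩
  obtain ⟨po, c, hgen, -, -⟩ := hG
  have := hgen.countable
  have := hgen.infinite
  exact conjugacy_reducible_isoOnClass G
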